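/- Let $\widehat C=(\widehat C_{ij})_{i,j\in I}$ be an affine Cartan matrix (twisted or untwisted), i.e. an indecomposable generalised Cartan matrix admitting a vector $u$ with positive integer entries and $\widehat C u=0$, and let $(a_i)_{i\in I}$ be its Kac labels: the coprime positive integers with $\sum_j\widehat C_{ij}a_j=0$ for all $i$. Let ${\frak h}'$ be the complex vector space with basis the simple co-roots $\check\alpha_i$ ($i\in I$), and let $\alpha_j\in({\frak h}')^*$ be given by $\alpha_j(\check\alpha_i)=\widehat C_{ij}$. Let $0\in I$ be a distinguished vertex (any choice is allowed), put ${\frak h}={\frak h}'\oplus\mathbb{C}d$, and extend the $\alpha_i$ to ${\frak h}$ by $\alpha_i(d)=0$ for $i\ne 0$ and $\delta(d)=1$, where $\delta=\sum_i a_i\alpha_i$. The simple reflections $s_i(x)=x-\alpha_i(x)\check\alpha_i$ act on ${\frak h}'$ and on ${\frak h}$. Let $\tau$ be a diagram automorphism, i.e. a permutation of $I$ with $\widehat C_{\tau(i)\tau(j)}=\widehat C_{ij}$ for all $i,j$ ($\tau=\mathrm{id}$ is allowed). It acts on ${\frak h}'$ by $\check\alpha_i\mapsto\check\alpha_{\tau(i)}$,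 and a lift of $\tau$ to ${\frak h}$ is a linear automorphism of ${\frak h}$ extending this action with $\alpha_{\tau(i)}(\tau(d))=\alpha_i(d)$ for all $i\in I$. Let $i_1,\dots,i_s$ be a set of representatives of the $\tau$-orbits on $I$ (one from each orbit), in any order, and let $\mathrm{cox}^\tau=s_{i_1}\cdots s_{i_s}\tau$ be the corresponding twisted Coxeter element. Then $1$ is a zero of multiplicity exactly $2$ of the characteristic polynomial of $\mathrm{cox}^\tau$ on ${\frak h}'$. Moreover $\tau$ has a lift to ${\frak h}$, and for every such lift, $1$ is a zero of multiplicity exactly $3$ of the characteristic polynomial of $\mathrm{cox}^\tau$ on ${\frak h}$. -/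

import Mathlib

namespace AffineCoxeter

/-- Indecomposable generalised Cartan matrices of affine type (twisted or untwisted): the affine
ones are those whose kernel contains a vector with positive integer entries. -/
structure IsAffineCartanMatrix {I : Type*} [Fintype I] (C : Matrix I I ℤ) : Prop where
  diag : ∀ i, C i i = 2
  offDiag_nonpos : ∀ i j, i ≠ j → C i j ≤ 0
  zero_symm : ∀ i j, C i j = 0 → C j i = 0
  indecomposable : ∀ S : Set I, S.Nonempty → Sᶜ.Nonempty → ∃ i ∈ S, ∃ j ∈ Sᶜ, C i j ≠ 0
  affine : ∃ u : I → ℕ, (∀ i, 0 < u i) ∧ C.mulVec (fun j => (u j : ℤ)) = 0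

/-- The Kac labels: the coprime positive integers `a i` such that `δ = ∑ i, a i • α i` vanishes on
all simple co-roots. -/
structure IsKacLabels {I : Type*} [Fintype I] (C : Matrix I I ℤ) (a : I → ℕ) : Prop where
  pos : ∀ i, 0 < a i
  mulVec_eq_zero : C.mulVec (fun j => (a j : ℤ)) = 0
  coprime : Finset.univ.gcd a = 1

/-- The automorphism group of the Dynkin diagram of `C`. -/
def diagramAut {I : Type*} (C : Matrix I I ℤ) : Subgroup (Equiv.Perm I) where
  carrier := {τ | ∀ i j, C (τ i) (τ j) = C i j}
  one_mem' := fun _ _ => rfl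
  mul_mem' := by
    intro σ τ hσ hτ i j
    exact (hσ (τ i) (τ j)).trans (hτ i j)
  inv_mem' := by
    intro τ hτ i j
    have h := hτ (τ⁻¹ i) (τ⁻¹ j)
    simpa using h.symm

/-- The list `L` contains exactly one element of every orbit of `τ`, each exactly once, in some
order. -/
def IsOrbitTransversal {I : Type*} (τ : Equiv.Perm I) (L : List I) : Prop :=
  L.Pairwise (fun i j => ¬ τ.SameCycle i j) ∧ ∀ i, ∃ j ∈ L, τ.SameCycle i j

/-! ### The space `𝔥'` -/

/-- `𝔥'`: the complex vector space with the simple co-roots as a basis. -/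
abbrev DerivedCartan (I : Type*) : Type _ := I → ℂ

/-- The simple co-root `α̌ i` in `𝔥'`. -/
def derivedCoroot {I : Type*} [DecidableEq I] (i : I) : DerivedCartan I := Pi.single i 1

/-- The simple root `α i` on `𝔥'`, with `α i (α̌ j) = C j i`. -/
def derivedRoot {I : Type*} [Fintype I] (C : Matrix I I ℤ) (i : I) :
    Module.Dual ℂ (DerivedCartan I) :=
  ∑ j, (C j i : ℂ) • LinearMap.proj j

theorem derivedRoot_coroot {I : Type*} [Fintype I] [DecidableEq I] (C : Matrix I I ℤ) (i j : I) :
    derivedRoot C i (derivedCoroot j) = C j i := by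
  simp [derivedRoot, derivedCoroot, Pi.single_apply]

/-- The simple reflection `s i x = x - α i (x) • α̌ i` on `𝔥'`. -/
def derivedReflection {I : Type*} [Fintype I] [DecidableEq I] (C : Matrix I I ℤ) (i : I) :
    Module.End ℂ (DerivedCartan I) :=
  Module.preReflection (derivedCoroot i) (derivedRoot C i)

/-- The action of a permutation of the vertices on `𝔥'`. -/
def derivedAut {I : Type*} (τ : Equiv.Perm I) : DerivedCartan I ≃ₗ[ℂ] DerivedCartan I :=
  LinearEquiv.funCongrLeft ℂ ℂ τ.symm

theorem derivedAut_coroot {I : Type*} [DecidableEq I] (τ : Equiv.Perm I) (i : I) :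
    derivedAut τ (derivedCoroot i) = derivedCoroot (τ i) := by
  ext j
  simp [derivedAut, derivedCoroot, LinearEquiv.funCongrLeft_apply, LinearMap.funLeft_apply,
    Pi.single_apply, Equiv.symm_apply_eq]

/-- The twisted Coxeter element `s (L 0) * ⋯ * s (L (s - 1)) * τ` acting on `𝔥'`. -/
def derivedTwistedCoxeter {I : Type*} [Fintype I] [DecidableEq I] (C : Matrix I I ℤ)
    (τ : Equiv.Perm I) (L : List I) : Module.End ℂ (DerivedCartan I) :=
  (L.map (derivedReflection C)).prod * (derivedAut τ).toLinearMap

/-! ### The space `𝔥 = 𝔥' ⊕ ℂ d` -/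

/-- `𝔥 = 𝔥' ⊕ ℂ d`. -/
abbrev FullCartan (I : Type*) : Type _ := DerivedCartan I × ℂ

/-- The element `d` of `𝔥`. -/
def d (I : Type*) : FullCartan I := (0, 1)

/-- The simple co-root `α̌ i` in `𝔥`. -/
def coroot {I : Type*} [DecidableEq I] (i : I) : FullCartan I := (derivedCoroot i, 0)

/-- The extension of the simple root `α i` to `𝔥`. The vertex `o` is the one labelled `0`; the value
of `α o` on `d` is the one for which `δ (d) = 1`. -/
noncomputable def root {I : Type*} [Fintype I] [DecidableEq I] (C : Matrix I I ℤ) (a : I → ℕ)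
    (o i : I) : Module.Dual ℂ (FullCartan I) :=
  (derivedRoot C i).coprod ((if i = o then (a o : ℂ)⁻¹ else 0) • LinearMap.id)

theorem root_d {I : Type*} [Fintype I] [DecidableEq I] (C : Matrix I I ℤ) (a : I → ℕ)
    {o i : I} (hi : i ≠ o) : root C a o i (d I) = 0 := by
  simp [root, d, hi]

theorem delta_d {I : Type*} [Fintype I] [DecidableEq I] (C : Matrix I I ℤ) (a : I → ℕ)
    (ha : IsKacLabels C a) (o : I) : (∑ i, (a i : ℂ) • root C a o i) (d I) = 1 := by
  have h : (a o : ℂ) ≠ 0 := by exact_mod_cast (ha.pos o).ne'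
  rw [LinearMap.sum_apply, Finset.sum_eq_single o]
  · simp [root, d, h]
  · intro i _ hi
    simp [root_d C a hi]
  · simp

/-- The simple reflection `s i x = x - α i (x) • α̌ i` on `𝔥`. -/
noncomputable def reflection {I : Type*} [Fintype I] [DecidableEq I] (C : Matrix I I ℤ)
    (a : I → ℕ) (o i : I) : Module.End ℂ (FullCartan I) :=
  Module.preReflection (coroot i) (root C a o i)

/-- `T` is a lift of the diagram automorphism `τ` to `𝔥`: it permutes the simple co-roots according
to `τ`, and `α (τ i) (T d) = α i (d)`. This determines `T d` up to adding multiples of the canonical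
central element. -/
structure IsLift {I : Type*} [Fintype I] [DecidableEq I] (C : Matrix I I ℤ) (a : I → ℕ) (o : I)
    (τ : Equiv.Perm I) (T : FullCartan I ≃ₗ[ℂ] FullCartan I) : Prop where
  map_coroot : ∀ i, T (coroot i) = coroot (τ i)
  root_map_d : ∀ i, root C a o (τ i) (T (d I)) = root C a o i (d I)

/-- The twisted Coxeter element `s (L 0) * ⋯ * s (L (s - 1)) * τ` acting on `𝔥`, where `τ` acts by
its lift `T`. -/
noncomputable def twistedCoxeter {I : Type*} [Fintype I] [DecidableEq I] (C : Matrix I I ℤ)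
    (a : I → ℕ) (o : I) (L : List I) (T : FullCartan I ≃ₗ[ℂ] FullCartan I) :
    Module.End ℂ (FullCartan I) :=
  (L.map (reflection C a o)).prod * T.toLinearMap

end AffineCoxeter

/-!
The coordinates of the vectors of `𝔥'` are taken with respect to the simple co-roots, so that a
positive vector `v` in the left kernel of `C` is a central element of `𝔥'`: all simple roots vanish
on it. Let `w = s_{i₁} ⋯ s_{iₛ} τ`.

*The invariant form.* The matrix `v i * C i j * a j` has vanishing row and column sums. It is
symmetric (`IsAffineCartanMatrix.symmetrizable`): otherwise its skew-symmetric part contains a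
directed cycle, and the inequality of the arithmetic and geometric mean forces all entries of `C`
along this cycle to be `-1` and `a` to be constant there, which is absurd. Hence it is a weighted
Laplacian of a connected graph. It follows that both kernels of `C` are one-dimensional, and that
`𝔥'` carries a positive semidefinite form, invariant under the simple reflections and `τ`, whose
radical is spanned by the central element `c`.

*The multiplicity on `𝔥'`.* If `w x = x`, then `x - τ x` is a combination of the simple co-roots
`α̌_{iᵣ}`, one for each orbit, with vanishing orbit sums. Hence `τ x = x`, and all simple roots vanish
on `x`; so the fixed vectors are the multiples of `c`. As `w` is unitary modulo `c`, the only Jordan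
block for the eigenvalue `1` has size at most two
(`IsAffineCartanMatrix.exists_eq_smul_central_of_mem_range`). It has size two because `w x = x + c` is
solvable (`IsAffineCartanMatrix.exists_derivedTwistedCoxeter_eq_add_central`). Here
`τ x - x = c - ρ`, where `ρ = ∑ n_{iᵣ} α̌_{iᵣ}` is determined by the vanishing of the orbit sums, and
`x` has to satisfy `s_{iₛ} ⋯ s_{i₁} x = x - ρ`; this prescribes the values `α_{iᵣ} x`. These values
are subject to a single linear relation, which expresses that `x` and `x - ρ` have the same norm.

*The multiplicity on `𝔥`.* The subspace `𝔥'` is stable under every lift of `w`, and `δ` shows that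
the action on `𝔥 / 𝔥'` is trivial, so the multiplicity increases by one. A lift exists because
`τ d - d` only has to satisfy equations compatible with the relation `δ = 0` on `𝔥'`.
-/

namespace AffineCoxeter

/-! ### Symmetrizability -/

section SymmetrizableCartan

variable {I : Type*} [Fintype I] [DecidableEq I] {C : Matrix I I ℤ} {a : I → ℕ}

theorem IsAffineCartanMatrix.sum_neg_offDiag_eq (hC : IsAffineCartanMatrix C)
    {u : I → ℤ} (hu : C.mulVec u = 0) (i : I) :
    ∑ j ∈ Finset.univ.erase i, -C i j * u j = 2 * u i := by
  have h := congrFun hu i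
  simp only [Matrix.mulVec, dotProduct, Pi.zero_apply] at h
  rw [← Finset.add_sum_erase _ _ (Finset.mem_univ i), hC.diag] at h
  simp only [neg_mul, Finset.sum_neg_distrib]
  linarith

/-- The absolute value of a vector in the left kernel of an affine Cartan matrix is in the left
kernel: the triangle inequality in each column becomes an equality after pairing with a positive
vector of the right kernel. -/
theorem IsAffineCartanMatrix.vecMul_abs_eq_zero (hC : IsAffineCartanMatrix C) {v : I → ℤ}
    (hv : Matrix.vecMul v C = 0) : Matrix.vecMul (fun i => |v i|) C = 0 := by
  obtain ⟨u, hu, hCu⟩ := hC.affine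
  have hle : ∀ j, Matrix.vecMul (fun i => |v i|) C j ≤ 0 := by
    intro j
    have h := congrFun hv j
    simp only [Matrix.vecMul, dotProduct, Pi.zero_apply] at h ⊢
    rw [← Finset.add_sum_erase _ _ (Finset.mem_univ j), hC.diag] at h ⊢
    have h1 : |v j * 2| ≤ ∑ i ∈ Finset.univ.erase j, |v i * C i j| := by
      rw [eq_neg_of_add_eq_zero_left h, abs_neg]
      exact Finset.abs_sum_le_sum_abs _ _
    have h2 : ∑ i ∈ Finset.univ.erase j, |v i * C i j|
        = -∑ i ∈ Finset.univ.erase j, |v i| * C i j := by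
      rw [← Finset.sum_neg_distrib]
      refine Finset.sum_congr rfl fun i hi => ?_
      rw [abs_mul, abs_of_nonpos (hC.offDiag_nonpos i j (Finset.ne_of_mem_erase hi)), mul_neg]
    rw [abs_mul, abs_two, h2] at h1
    linarith
  have hsum : ∑ j, Matrix.vecMul (fun i => |v i|) C j * (u j : ℤ) = 0 := by
    change Matrix.vecMul (fun i => |v i|) C ⬝ᵥ (fun j => (u j : ℤ)) = 0
    rw [← Matrix.dotProduct_mulVec, hCu, dotProduct_zero]
  funext j
  have h := (Finset.sum_eq_zero_iff_of_nonpos fun j _ =>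
    mul_nonpos_of_nonpos_of_nonneg (hle j) (Int.natCast_nonneg (u j))).1 hsum j (Finset.mem_univ j)
  exact (mul_eq_zero.1 h).resolve_right (by exact_mod_cast (hu j).ne')

theorem IsAffineCartanMatrix.exists_pos_vecMul_eq_zero [Nonempty I]
    (hC : IsAffineCartanMatrix C) :
    ∃ v : I → ℤ, (∀ i, 0 < v i) ∧ Matrix.vecMul v C = 0 := by
  obtain ⟨u, hu, hCu⟩ := hC.affine
  have hdet : C.det = 0 := Matrix.exists_mulVec_eq_zero_iff.1
    ⟨_, fun h => (hu (Classical.arbitrary I)).ne'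
      (Int.natCast_eq_zero.1 (congrFun h (Classical.arbitrary I))), hCu⟩
  obtain ⟨v, hv0, hv⟩ := Matrix.exists_vecMul_eq_zero_iff.2 hdet
  have hw := hC.vecMul_abs_eq_zero hv
  refine ⟨fun i => |v i|, fun i => ?_, hw⟩
  by_contra hi
  obtain ⟨p, hp⟩ := Function.ne_iff.1 hv0
  -- a column outside the support of `v` would be a relation between terms of the same sign
  obtain ⟨q, hq, j, hj, hqj⟩ := hC.indecomposable {i | v i ≠ 0} ⟨p, hp⟩
    ⟨i, by simpa using hi⟩
  have hj : v j = 0 := by simpa using hj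
  have h := congrFun hw j
  simp only [Matrix.vecMul, dotProduct, Pi.zero_apply] at h
  have hz := (Finset.sum_eq_zero_iff_of_nonpos fun i _ => by
    by_cases hij : i = j
    · simp [hij, hj]
    · exact mul_nonpos_of_nonneg_of_nonpos (abs_nonneg _) (hC.offDiag_nonpos i j hij)).1 h q
      (Finset.mem_univ q)
  rcases mul_eq_zero.1 hz with h0 | h0
  · exact hq (abs_eq_zero.1 h0)
  · exact hqj h0

/-- A self-map of a nonempty finite set restricts to a surjection of some nonempty subset. -/
theorem exists_subset_image_eq {α : Type*} [DecidableEq α] (f : α → α) {S : Finset α}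
    (hS : S.Nonempty) (hf : ∀ x ∈ S, f x ∈ S) :
    ∃ P ⊆ S, P.Nonempty ∧ P.image f = P := by
  induction S using Finset.strongInduction with
  | H S ih =>
    have hsub : S.image f ⊆ S := Finset.image_subset_iff.2 hf
    by_cases h : S.image f = S
    · exact ⟨S, subset_rfl, hS, h⟩
    · obtain ⟨P, hP, hP'⟩ := ih _ (hsub.ssubset_of_ne h) (hS.image f)
        fun x hx => Finset.mem_image_of_mem f (hsub hx)
      exact ⟨P, hP.trans hsub, hP'⟩

/-- On a cycle of length at least three, the entries of an affine Cartan matrix between neighbours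
are all `-1` and the Kac labels are constant: by the inequality between the arithmetic and the
geometric mean, the sum over the cycle of the relations `∑ j, C i j * a j = 0`, divided by `a i`,
leaves no room for anything else. -/
theorem IsAffineCartanMatrix.eq_neg_one_of_cycle (hC : IsAffineCartanMatrix C)
    (hpos : ∀ i, 0 < a i) (ha : C.mulVec (fun j => (a j : ℤ)) = 0) {f : I → I} {P : Finset I}
    (hP : P.image f = P) (hne : ∀ p ∈ P, f p ≠ p) (hne2 : ∀ p ∈ P, f (f p) ≠ p)
    (hadj : ∀ p ∈ P, C p (f p) ≠ 0) {p : I} (hp : p ∈ P) :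
    C p (f p) = -1 ∧ C (f p) p = -1 ∧ a (f p) = a p := by
  have hinj : Set.InjOn f P := Finset.card_image_iff.1 (by rw [hP])
  have hfP : ∀ p ∈ P, f p ∈ P := fun p hp => hP ▸ Finset.mem_image_of_mem f hp
  have ha0 : ∀ i, (0 : ℚ) < a i := fun i => by exact_mod_cast hpos i
  have hk : ∀ p ∈ P, (1 : ℚ) ≤ -C p (f p) := fun p hp => by
    have h1 := hC.offDiag_nonpos p (f p) (hne p hp).symm
    have h2 := hadj p hp
    have h3 : 1 ≤ -C p (f p) := by omega
    exact_mod_cast h3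
  have hl : ∀ p ∈ P, (1 : ℚ) ≤ -C (f p) p := fun p hp => by
    have h1 := hC.offDiag_nonpos (f p) p (hne p hp)
    have h2 : C (f p) p ≠ 0 := fun h => hadj p hp (hC.zero_symm _ _ h)
    have h3 : 1 ≤ -C (f p) p := by omega
    exact_mod_cast h3
  have hrow : ∀ p ∈ P,
      (-C (f p) (f (f p)) : ℚ) * (a (f (f p)) / a (f p)) + -C (f p) p * (a p / a (f p)) ≤ 2 := by
    intro p hp
    have h := hC.sum_neg_offDiag_eq ha (f p)
    have hsub : ({f (f p), p} : Finset I) ⊆ Finset.univ.erase (f p) := by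
      intro x hx
      simp only [Finset.mem_insert, Finset.mem_singleton] at hx
      rcases hx with rfl | rfl
      · simpa using hne _ (hfP p hp)
      · simpa using (hne _ hp).symm
    have h1 := Finset.sum_le_sum_of_subset_of_nonneg (f := fun j => -C (f p) j * (a j : ℤ)) hsub
      fun j hj _ => mul_nonneg
        (neg_nonneg.2 (hC.offDiag_nonpos _ _ (Finset.ne_of_mem_erase hj).symm))
        (Int.natCast_nonneg _)
    rw [h, Finset.sum_pair (hne2 p hp)] at h1
    have h2 : (-C (f p) (f (f p)) : ℚ) * a (f (f p)) + -C (f p) p * a p ≤ 2 * a (f p) := by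
      exact_mod_cast h1
    rw [← mul_div_assoc, ← mul_div_assoc, ← add_div, div_le_iff₀ (ha0 _)]
    exact h2
  have hmean : ∀ p ∈ P,
      2 + ((-C p (f p) - 1 : ℚ) * (a (f p) / a p) + (-C (f p) p - 1) * (a p / a (f p))
        + (a (f p) - a p) ^ 2 / (a p * a (f p)))
      = -C p (f p) * (a (f p) / a p) + -C (f p) p * (a p / a (f p)) := by
    intro p _
    have h1 := (ha0 p).ne'
    have h2 := (ha0 (f p)).ne'
    field_simp
    ring
  have h1 : ∀ p ∈ P, 0 ≤ (-C p (f p) - 1 : ℚ) * (a (f p) / a p) := fun p hp =>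
    mul_nonneg (by linarith [hk p hp]) (div_nonneg (ha0 _).le (ha0 _).le)
  have h2 : ∀ p ∈ P, 0 ≤ (-C (f p) p - 1 : ℚ) * (a p / a (f p)) := fun p hp =>
    mul_nonneg (by linarith [hl p hp]) (div_nonneg (ha0 _).le (ha0 _).le)
  have h3 : ∀ p : I, 0 ≤ (a (f p) - a p : ℚ) ^ 2 / (a p * a (f p)) := fun p =>
    div_nonneg (sq_nonneg _) (mul_pos (ha0 _) (ha0 _)).le
  have hsum : ∑ p ∈ P, ((-C p (f p) - 1 : ℚ) * (a (f p) / a p) + (-C (f p) p - 1) * (a p / a (f p))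
        + (a (f p) - a p) ^ 2 / (a p * a (f p))) = 0 := by
    apply le_antisymm _ (Finset.sum_nonneg fun p hp => by linarith [h1 p hp, h2 p hp, h3 p])
    have e1 := Finset.sum_congr rfl hmean
    have e2 := Finset.sum_le_sum hrow
    rw [Finset.sum_add_distrib] at e1 e2
    have e3 : ∑ p ∈ P, (-C (f p) (f (f p)) : ℚ) * (a (f (f p)) / a (f p))
        = ∑ p ∈ P, (-C p (f p) : ℚ) * (a (f p) / a p) := by
      conv_rhs => rw [← hP]
      exact (Finset.sum_image (f := fun p => (-C p (f p) : ℚ) * (a (f p) / a p)) hinj).symm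
    rw [e3, ← Finset.sum_add_distrib, ← e1] at e2
    linarith
  have hz := (Finset.sum_eq_zero_iff_of_nonneg fun p hp => by
    linarith [h1 p hp, h2 p hp, h3 p]).1 hsum p hp
  have z1 : (-C p (f p) - 1 : ℚ) * (a (f p) / a p) = 0 := by linarith [h1 p hp, h2 p hp, h3 p]
  have z2 : (-C (f p) p - 1 : ℚ) * (a p / a (f p)) = 0 := by linarith [h1 p hp, h2 p hp, h3 p]
  have z3 : (a (f p) - a p : ℚ) ^ 2 / (a p * a (f p)) = 0 := by linarith [h1 p hp, h2 p hp, h3 p]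
  have w1 := (mul_eq_zero.1 z1).resolve_right (div_pos (ha0 _) (ha0 _)).ne'
  have w2 := (mul_eq_zero.1 z2).resolve_right (div_pos (ha0 _) (ha0 _)).ne'
  have w3 := pow_eq_zero_iff (two_ne_zero) |>.1
    ((div_eq_zero_iff.1 z3).resolve_right (mul_pos (ha0 _) (ha0 _)).ne')
  refine ⟨?_, ?_, ?_⟩
  · have : (C p (f p) : ℚ) = -1 := by linarith
    exact_mod_cast this
  · have : (C (f p) p : ℚ) = -1 := by linarith
    exact_mod_cast this
  · have : (a (f p) : ℚ) = a p := by linarith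
    exact_mod_cast this

/-- Affine Cartan matrices are symmetrizable, and the symmetrizer is the quotient of the positive
vectors in the left and the right kernel. The skew-symmetric part of `v i * C i j * a j` has
vanishing row sums, so if it were nonzero, its positive entries would contain a cycle, along which
`v` would have to increase strictly. -/
theorem IsAffineCartanMatrix.symmetrizable (hC : IsAffineCartanMatrix C)
    (hpos : ∀ i, 0 < a i) (ha : C.mulVec (fun j => (a j : ℤ)) = 0)
    {v : I → ℤ} (hv : Matrix.vecMul v C = 0) (i j : I) :
    v i * C i j * a j = v j * C j i * a i := by
  set N : I → I → ℤ := fun i j => v i * C i j * a j - v j * C j i * a i with hN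
  have hrow : ∀ i, ∑ j, N i j = 0 := by
    intro i
    have h1 := congrFun ha i
    have h2 := congrFun hv i
    simp only [Matrix.mulVec, Matrix.vecMul, dotProduct, Pi.zero_apply] at h1 h2
    simp only [hN, Finset.sum_sub_distrib, mul_assoc, ← Finset.mul_sum, h1]
    simp only [← mul_assoc, ← Finset.sum_mul, h2]
    simp
  have hskew : ∀ i j, N j i = -N i j := fun i j => by simp [hN]
  have hex : ∀ i j, N i j < 0 → ∃ k, 0 < N i k := by
    intro i j hij
    by_contra! h
    exact (Finset.sum_neg' (fun k _ => h k) ⟨j, Finset.mem_univ j, hij⟩).ne (hrow i)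
  suffices ∀ i j, N i j ≤ 0 by
    have h1 := this i j
    have h2 := this j i
    simp only [hN] at h1 h2
    linarith
  by_contra! hcon
  classical
  obtain ⟨i₀, j₀, h₀⟩ := hcon
  have hex' : ∀ i, ∃ k, (∃ j, 0 < N i j) → 0 < N i k := by
    intro i
    by_cases h : ∃ j, 0 < N i j
    · exact ⟨h.choose, fun _ => h.choose_spec⟩
    · exact ⟨i, fun h' => absurd h' h⟩
  choose f hf using hex'
  obtain ⟨P, hPS, hPne, hP⟩ := exists_subset_image_eq f
    (S := Finset.univ.filter fun i => ∃ j, 0 < N i j) ⟨i₀, by simpa using ⟨j₀, h₀⟩⟩ (by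
      intro i hi
      have hi : ∃ j, 0 < N i j := by simpa using hi
      have := hex (f i) i (by rw [hskew]; linarith [hf i hi])
      simpa using this)
  have hNf : ∀ p ∈ P, 0 < N p (f p) := fun p hp => hf p (by simpa using hPS hp)
  have hfP : ∀ p ∈ P, f p ∈ P := fun p hp => hP ▸ Finset.mem_image_of_mem f hp
  have hcyc := fun p (hp : p ∈ P) => hC.eq_neg_one_of_cycle hpos ha hP
    (fun p hp h => by
      have := hNf p hp
      rw [h] at this
      simp [hN] at this)
    (fun p hp h => by
      have h1 := hNf p hp
      have h2 := hNf _ (hfP p hp)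
      rw [h, hskew] at h2
      linarith)
    (fun p hp h => by
      have := hNf p hp
      simp [hN, h, hC.zero_symm _ _ h] at this) hp
  have hlt : ∑ p ∈ P, v p * a p < ∑ p ∈ P, v (f p) * a (f p) := by
    refine Finset.sum_lt_sum_of_nonempty hPne fun p hp => ?_
    obtain ⟨h1, h2, h3⟩ := hcyc p hp
    have := hNf p hp
    simp only [hN, h1, h2, h3] at this
    rw [h3]
    linarith
  have hinj : Set.InjOn f P := Finset.card_image_iff.1 (by rw [hP])
  rw [← Finset.sum_image (f := fun p => v p * (a p : ℤ)) hinj, hP] at hlt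
  exact lt_irrefl _ hlt

end SymmetrizableCartan

/-! ### The kernels of an affine Cartan matrix -/

section Kernels

variable {I : Type*} [Fintype I] [DecidableEq I] {C : Matrix I I ℤ} {a : I → ℕ} {v : I → ℤ}

/-- A positive integral vector in the left kernel of `C`, i.e. a multiple of the vector of dual Kac
labels. -/
structure IsDualLabels (C : Matrix I I ℤ) (v : I → ℤ) : Prop where
  pos : ∀ i, 0 < v i
  vecMul_eq_zero : Matrix.vecMul v C = 0

/-- The central element of `𝔥'` with the coordinates `v` in the basis of simple co-roots. -/
def central (v : I → ℤ) : DerivedCartan I := fun i => v i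

omit [DecidableEq I] in
theorem derivedRoot_apply (C : Matrix I I ℤ) (j : I) (x : DerivedCartan I) :
    derivedRoot C j x = ∑ i, (C i j : ℂ) * x i := by
  simp [derivedRoot]

omit [DecidableEq I] in
theorem IsDualLabels.cast_ne_zero (hv : IsDualLabels C v) (i : I) : (v i : ℂ) ≠ 0 := by
  exact_mod_cast (hv.pos i).ne'

omit [DecidableEq I] in
theorem IsKacLabels.cast_ne_zero (ha : IsKacLabels C a) (i : I) : (a i : ℂ) ≠ 0 := by
  exact_mod_cast (ha.pos i).ne'

omit [DecidableEq I] in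
theorem IsDualLabels.derivedRoot_central (hv : IsDualLabels C v) (j : I) :
    derivedRoot C j (central v) = 0 := by
  have h := congrFun hv.vecMul_eq_zero j
  simp only [Matrix.vecMul, dotProduct, Pi.zero_apply] at h
  rw [derivedRoot_apply]
  simp only [central, mul_comm (C _ j : ℂ)]
  exact_mod_cast h

omit [DecidableEq I] in
theorem IsKacLabels.sum_mul_derivedRoot (ha : IsKacLabels C a) (x : DerivedCartan I) :
    ∑ j, (a j : ℂ) * derivedRoot C j x = 0 := by
  simp only [derivedRoot_apply, Finset.mul_sum]
  rw [Finset.sum_comm]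
  refine Finset.sum_eq_zero fun i _ => ?_
  have h := congrFun ha.mulVec_eq_zero i
  simp only [Matrix.mulVec, dotProduct, Pi.zero_apply] at h
  have h' : ∑ j, (C i j : ℂ) * (a j : ℂ) = 0 := by exact_mod_cast h
  rw [← zero_mul (x i), ← h', Finset.sum_mul]
  exact Finset.sum_congr rfl fun j _ => by ring

omit [DecidableEq I] in
/-- The Hermitian form of a symmetric matrix with vanishing row sums is a Dirichlet energy. -/
theorem sum_mul_normSq_sub (F : I → I → ℂ) (hsymm : ∀ i j, F i j = F j i)
    (hrow : ∀ i, ∑ j, F i j = 0) (y : I → ℂ) :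
    ∑ i, ∑ j, F i j * Complex.normSq (y i - y j)
      = -2 * ∑ i, ∑ j, F i j * (star (y i) * y j) := by
  have h1 : ∑ i, ∑ j, F i j * (star (y i) * y i) = 0 :=
    Finset.sum_eq_zero fun i _ => by rw [← Finset.sum_mul, hrow, zero_mul]
  have h2 : ∑ i, ∑ j, F i j * (star (y j) * y j) = 0 := by
    rw [Finset.sum_comm]
    exact Finset.sum_eq_zero fun i _ => by
      simp only [fun j => hsymm j i]
      rw [← Finset.sum_mul, hrow, zero_mul]
  have h3 : ∑ i, ∑ j, F i j * (star (y j) * y i) = ∑ i, ∑ j, F i j * (star (y i) * y j) := by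
    rw [Finset.sum_comm]
    simp only [fun i j => hsymm j i]
  have h4 : ∀ i j, F i j * (Complex.normSq (y i - y j) : ℂ)
      = F i j * (star (y i) * y i) + F i j * (star (y j) * y j)
        - F i j * (star (y j) * y i) - F i j * (star (y i) * y j) := by
    intro i j
    rw [Complex.normSq_eq_conj_mul_self, map_sub]
    simp only [Complex.star_def]
    ring
  simp only [h4, Finset.sum_sub_distrib, Finset.sum_add_distrib, h1, h2, h3]
  ring

omit [DecidableEq I] in
theorem IsAffineCartanMatrix.exists_eq_const (hC : IsAffineCartanMatrix C) {α : Type*} [Nonempty α]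
    {y : I → α} (h : ∀ i j, C i j ≠ 0 → y i = y j) : ∃ t, ∀ i, y i = t := by
  rcases isEmpty_or_nonempty I with hI | ⟨⟨o⟩⟩
  · exact ⟨Classical.arbitrary α, fun i => hI.elim i⟩
  refine ⟨y o, fun i => ?_⟩
  by_contra hi
  obtain ⟨p, hp, q, hq, hpq⟩ := hC.indecomposable {i | y i = y o} ⟨o, rfl⟩ ⟨i, hi⟩
  exact hq ((h p q hpq).symm.trans hp)

/-- The Hermitian form attached to the symmetrized matrix `v i * C i j * a j` is semidefinite, and
its isotropic vectors are constant. -/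
theorem IsAffineCartanMatrix.exists_eq_const_of_sum_eq_zero (hC : IsAffineCartanMatrix C)
    (ha : IsKacLabels C a) (hv : IsDualLabels C v) {y : I → ℂ}
    (h : ∑ i, ∑ j, ((v i * C i j * a j : ℤ) : ℂ) * (star (y i) * y j) = 0) :
    ∃ t, ∀ i, y i = t := by
  have hsymm := hC.symmetrizable ha.pos ha.mulVec_eq_zero hv.vecMul_eq_zero
  have hE := sum_mul_normSq_sub (fun i j => ((v i * C i j * a j : ℤ) : ℂ))
    (fun i j => by rw [hsymm]) (fun i => by
      have h := congrFun ha.mulVec_eq_zero i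
      simp only [Matrix.mulVec, dotProduct, Pi.zero_apply] at h
      have h' : ∑ j, v i * C i j * (a j : ℤ) = 0 := by
        simp only [mul_assoc, ← Finset.mul_sum, h, mul_zero]
      exact_mod_cast h') y
  rw [h, mul_zero] at hE
  have hE' : ∑ i, ∑ j, ((v i * C i j * a j : ℤ) : ℝ) * Complex.normSq (y i - y j) = 0 := by
    exact_mod_cast hE
  have hnonpos : ∀ i j, ((v i * C i j * a j : ℤ) : ℝ) * Complex.normSq (y i - y j) ≤ 0 := by
    intro i j
    by_cases hij : i = j
    · simp [hij]
    · refine mul_nonpos_of_nonpos_of_nonneg ?_ (Complex.normSq_nonneg _)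
      have : v i * C i j * a j ≤ 0 := mul_nonpos_of_nonpos_of_nonneg
        (mul_nonpos_of_nonneg_of_nonpos (hv.pos i).le (hC.offDiag_nonpos i j hij))
        (Int.natCast_nonneg _)
      exact_mod_cast this
  refine hC.exists_eq_const fun i j hij => ?_
  have h1 := (Finset.sum_eq_zero_iff_of_nonpos fun i _ =>
    Finset.sum_nonpos fun j _ => hnonpos i j).1 hE' i (Finset.mem_univ i)
  have h2 := (Finset.sum_eq_zero_iff_of_nonpos fun j _ => hnonpos i j).1 h1 j (Finset.mem_univ j)
  have h3 : ((v i * C i j * a j : ℤ) : ℝ) ≠ 0 := by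
    have : v i * C i j * a j ≠ 0 := mul_ne_zero (mul_ne_zero (hv.pos i).ne' hij)
      (by exact_mod_cast (ha.pos j).ne')
    exact_mod_cast this
  exact sub_eq_zero.1 (Complex.normSq_eq_zero.1 ((mul_eq_zero.1 h2).resolve_left h3))

theorem IsAffineCartanMatrix.exists_eq_smul_central (hC : IsAffineCartanMatrix C)
    (ha : IsKacLabels C a) (hv : IsDualLabels C v) {x : DerivedCartan I}
    (hx : ∀ j, derivedRoot C j x = 0) : ∃ t : ℂ, x = t • central v := by
  obtain ⟨t, ht⟩ := hC.exists_eq_const_of_sum_eq_zero ha hv (y := fun i => star (x i / v i)) (by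
    rw [Finset.sum_comm]
    refine Finset.sum_eq_zero fun j _ => ?_
    rw [← mul_zero ((a j : ℂ) * star (x j / v j)), ← hx j, derivedRoot_apply, Finset.mul_sum]
    refine Finset.sum_congr rfl fun i _ => ?_
    have := hv.cast_ne_zero i
    push_cast
    rw [star_star]
    field_simp)
  refine ⟨star t, ?_⟩
  funext i
  have := hv.cast_ne_zero i
  rw [← ht i, star_star, Pi.smul_apply, smul_eq_mul, central, div_mul_cancel₀ _ this]

theorem IsAffineCartanMatrix.exists_eq_mul_label (hC : IsAffineCartanMatrix C)
    (ha : IsKacLabels C a) (hv : IsDualLabels C v) {b : I → ℂ}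
    (hb : ∀ i, ∑ j, (C i j : ℂ) * b j = 0) : ∃ t : ℂ, ∀ j, b j = t * a j := by
  obtain ⟨t, ht⟩ := hC.exists_eq_const_of_sum_eq_zero ha hv (y := fun i => b i / a i) (by
    refine Finset.sum_eq_zero fun i _ => ?_
    rw [← mul_zero ((v i : ℂ) * star (b i / a i)), ← hb i, Finset.mul_sum]
    refine Finset.sum_congr rfl fun j _ => ?_
    have := ha.cast_ne_zero j
    push_cast
    field_simp)
  refine ⟨t, fun j => ?_⟩
  have := ha.cast_ne_zero j
  rw [← ht j, div_mul_cancel₀ _ this]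

omit [DecidableEq I] in
theorem eq_one_of_comp_perm_eq_mul {τ : Equiv.Perm I} {u : I → ℂ} {t : ℂ} (hu : ∑ i, u i ≠ 0)
    (h : ∀ i, u (τ i) = t * u i) : t = 1 := by
  have h1 : ∑ i, u (τ i) = ∑ i, u i := Equiv.sum_comp τ u
  simp only [h, ← Finset.mul_sum] at h1
  exact mul_right_cancel₀ hu (h1.trans (one_mul _).symm)

theorem IsAffineCartanMatrix.label_apply_aut [Nonempty I] (hC : IsAffineCartanMatrix C)
    (ha : IsKacLabels C a) (hv : IsDualLabels C v) {τ : Equiv.Perm I} (hτ : τ ∈ diagramAut C)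
    (i : I) : a (τ i) = a i := by
  obtain ⟨t, ht⟩ := hC.exists_eq_mul_label ha hv (b := fun j => a (τ j)) (fun i => by
    have h := congrFun ha.mulVec_eq_zero (τ i)
    simp only [Matrix.mulVec, dotProduct, Pi.zero_apply] at h
    rw [← Equiv.sum_comp τ] at h
    simp only [fun j => hτ i j] at h
    exact_mod_cast h)
  have hpos : 0 < ∑ i, a i := Finset.sum_pos (fun i _ => ha.pos i) Finset.univ_nonempty
  have h1 := eq_one_of_comp_perm_eq_mul (u := fun i => (a i : ℂ))
    (by exact_mod_cast hpos.ne') ht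
  have h2 := ht i
  rw [h1, one_mul] at h2
  exact_mod_cast h2

omit [Fintype I] [DecidableEq I] in
theorem derivedAut_apply (τ : Equiv.Perm I) (x : DerivedCartan I) (i : I) :
    derivedAut τ x i = x (τ.symm i) := rfl

omit [DecidableEq I] in
theorem derivedRoot_derivedAut {τ : Equiv.Perm I} (hτ : τ ∈ diagramAut C) (i : I)
    (x : DerivedCartan I) : derivedRoot C (τ i) (derivedAut τ x) = derivedRoot C i x := by
  rw [derivedRoot_apply, derivedRoot_apply, ← Equiv.sum_comp τ]
  simp only [derivedAut_apply, Equiv.symm_apply_apply, fun j => hτ j i]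

theorem IsAffineCartanMatrix.derivedAut_central [Nonempty I] (hC : IsAffineCartanMatrix C)
    (ha : IsKacLabels C a) (hv : IsDualLabels C v) {τ : Equiv.Perm I} (hτ : τ ∈ diagramAut C) :
    derivedAut τ (central v) = central v := by
  obtain ⟨t, ht⟩ := hC.exists_eq_smul_central ha hv (x := derivedAut τ (central v)) (fun j => by
    rw [← Equiv.apply_symm_apply τ j, derivedRoot_derivedAut hτ, hv.derivedRoot_central])
  have hpos : 0 < ∑ i, v i := Finset.sum_pos (fun i _ => hv.pos i) Finset.univ_nonempty
  have h1 := eq_one_of_comp_perm_eq_mul (τ := τ.symm) (u := fun i => (v i : ℂ)) (t := t)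
    (by exact_mod_cast hpos.ne') (fun i => congrFun ht i)
  rw [ht, h1, one_smul]

theorem IsAffineCartanMatrix.dualLabel_apply_aut [Nonempty I] (hC : IsAffineCartanMatrix C)
    (ha : IsKacLabels C a) (hv : IsDualLabels C v) {τ : Equiv.Perm I} (hτ : τ ∈ diagramAut C)
    (i : I) : v (τ i) = v i := by
  have h := congrFun (hC.derivedAut_central ha hv hτ) (τ i)
  rw [derivedAut_apply, Equiv.symm_apply_apply] at h
  exact_mod_cast (show (v i : ℂ) = v (τ i) from h).symm

/-- The only linear relation between the simple roots on `𝔥'` is `δ = 0`, so that values can be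
prescribed up to this relation. -/
theorem IsAffineCartanMatrix.exists_derivedRoot_eq (hC : IsAffineCartanMatrix C)
    (ha : IsKacLabels C a) (hv : IsDualLabels C v) {e : I → ℂ} (he : ∑ j, (a j : ℂ) * e j = 0) :
    ∃ x, ∀ j, derivedRoot C j x = e j := by
  by_contra! hcon
  have hmem : e ∉ LinearMap.range (LinearMap.pi (derivedRoot C)) := by
    rintro ⟨x, hx⟩
    obtain ⟨j, hj⟩ := hcon x
    exact hj (congrFun hx j)
  obtain ⟨φ, hφe, hφ⟩ := Submodule.exists_le_ker_of_notMem hmem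
  obtain ⟨t, ht⟩ := hC.exists_eq_mul_label ha hv
    (b := fun j => φ (fun k => if j = k then 1 else 0)) (fun i => by
    have h := hφ (LinearMap.mem_range_self _ (derivedCoroot i))
    rw [LinearMap.mem_ker, LinearMap.pi_apply_eq_sum_univ φ] at h
    simpa [derivedRoot_coroot] using h)
  apply hφe
  rw [LinearMap.pi_apply_eq_sum_univ φ]
  simp only [ht, smul_eq_mul]
  rw [← mul_zero t, ← he, Finset.mul_sum]
  exact Finset.sum_congr rfl fun j _ => by ring

end Kernels

/-! ### The invariant form on `𝔥'` -/

section InvariantForm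

variable {I : Type*} [Fintype I] [DecidableEq I] {C : Matrix I I ℤ} {a : I → ℕ} {v : I → ℤ}

/-- The invariant symmetric bilinear form on `𝔥'`, normalised by
`(α̌ i, x) = (a i / v i) * α i (x)`. -/
noncomputable def invariantForm (C : Matrix I I ℤ) (a : I → ℕ) (v : I → ℤ) :
    LinearMap.BilinForm ℂ (DerivedCartan I) :=
  Matrix.toBilin' (Matrix.of fun i j => (C i j : ℂ) * (a j / v j))

theorem invariantForm_apply (x y : DerivedCartan I) :
    invariantForm C a v x y = ∑ i, ∑ j, x i * ((C i j : ℂ) * (a j / v j)) * y j := by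
  simp [invariantForm, Matrix.toBilin'_apply]

theorem invariantForm_eq_sum_derivedRoot (x y : DerivedCartan I) :
    invariantForm C a v x y = ∑ j, derivedRoot C j x * (a j / v j * y j) := by
  rw [invariantForm_apply, Finset.sum_comm]
  refine Finset.sum_congr rfl fun j _ => ?_
  rw [derivedRoot_apply, Finset.sum_mul]
  exact Finset.sum_congr rfl fun i _ => by ring

theorem invariantForm_coroot_right (x : DerivedCartan I) (i : I) :
    invariantForm C a v x (derivedCoroot i) = (a i / v i) * derivedRoot C i x := by
  simp [invariantForm_eq_sum_derivedRoot, derivedCoroot, Pi.single_apply, mul_comm]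

theorem IsAffineCartanMatrix.invariantForm_comm (hC : IsAffineCartanMatrix C)
    (ha : IsKacLabels C a) (hv : IsDualLabels C v) (x y : DerivedCartan I) :
    invariantForm C a v x y = invariantForm C a v y x := by
  rw [invariantForm_apply, invariantForm_apply, Finset.sum_comm]
  refine Finset.sum_congr rfl fun i _ => Finset.sum_congr rfl fun j _ => ?_
  have h := hC.symmetrizable ha.pos ha.mulVec_eq_zero hv.vecMul_eq_zero j i
  have h' : (v j : ℂ) * C j i * a i = v i * C i j * a j := by exact_mod_cast h
  have h1 := hv.cast_ne_zero i
  have h2 := hv.cast_ne_zero j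
  have h3 : (C j i : ℂ) * (a i / v i) = (C i j : ℂ) * (a j / v j) := by
    field_simp
    linear_combination h'
  rw [h3]
  ring

theorem IsAffineCartanMatrix.invariantForm_coroot_left (hC : IsAffineCartanMatrix C)
    (ha : IsKacLabels C a) (hv : IsDualLabels C v) (i : I) (x : DerivedCartan I) :
    invariantForm C a v (derivedCoroot i) x = (a i / v i) * derivedRoot C i x := by
  rw [hC.invariantForm_comm ha hv, invariantForm_coroot_right]

theorem IsDualLabels.invariantForm_central_left (hv : IsDualLabels C v) (x : DerivedCartan I) :
    invariantForm C a v (central v) x = 0 := by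
  simp [invariantForm_eq_sum_derivedRoot, hv.derivedRoot_central]

theorem IsAffineCartanMatrix.invariantForm_central_right (hC : IsAffineCartanMatrix C)
    (ha : IsKacLabels C a) (hv : IsDualLabels C v) (x : DerivedCartan I) :
    invariantForm C a v x (central v) = 0 := by
  rw [hC.invariantForm_comm ha hv, hv.invariantForm_central_left]

/-- Modulo the central element, the Hermitian extension of the invariant form is definite. -/
theorem IsAffineCartanMatrix.exists_eq_smul_central_of_isotropic (hC : IsAffineCartanMatrix C)
    (ha : IsKacLabels C a) (hv : IsDualLabels C v) {x : DerivedCartan I}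
    (h : invariantForm C a v (star x) x = 0) : ∃ t : ℂ, x = t • central v := by
  obtain ⟨t, ht⟩ := hC.exists_eq_const_of_sum_eq_zero ha hv (y := fun i => x i / v i) (by
    rw [invariantForm_apply] at h
    rw [← h]
    refine Finset.sum_congr rfl fun i _ => Finset.sum_congr rfl fun j _ => ?_
    have h1 := hv.cast_ne_zero i
    have h2 := hv.cast_ne_zero j
    have h3 : star (v i : ℂ) = v i := by simp
    rw [star_div₀, h3, Pi.star_apply]
    push_cast
    field_simp)
  refine ⟨t, ?_⟩
  funext i
  rw [← ht i, Pi.smul_apply, smul_eq_mul, central, div_mul_cancel₀ _ (hv.cast_ne_zero i)]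

theorem derivedReflection_apply (i : I) (x : DerivedCartan I) :
    derivedReflection C i x = x - derivedRoot C i x • derivedCoroot i := rfl

theorem IsAffineCartanMatrix.invariantForm_derivedReflection (hC : IsAffineCartanMatrix C)
    (ha : IsKacLabels C a) (hv : IsDualLabels C v) (i : I) (x y : DerivedCartan I) :
    invariantForm C a v (derivedReflection C i x) (derivedReflection C i y)
      = invariantForm C a v x y := by
  simp only [derivedReflection_apply, map_sub, map_smul, LinearMap.sub_apply, LinearMap.smul_apply,
    smul_eq_mul, invariantForm_coroot_right, hC.invariantForm_coroot_left ha hv,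
    derivedRoot_coroot, hC.diag]
  push_cast
  ring

theorem IsAffineCartanMatrix.invariantForm_derivedAut [Nonempty I] (hC : IsAffineCartanMatrix C)
    (ha : IsKacLabels C a) (hv : IsDualLabels C v) {τ : Equiv.Perm I} (hτ : τ ∈ diagramAut C)
    (x y : DerivedCartan I) :
    invariantForm C a v (derivedAut τ x) (derivedAut τ y) = invariantForm C a v x y := by
  rw [invariantForm_eq_sum_derivedRoot, invariantForm_eq_sum_derivedRoot, ← Equiv.sum_comp τ]
  simp only [derivedRoot_derivedAut hτ, derivedAut_apply, Equiv.symm_apply_apply,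
    hC.label_apply_aut ha hv hτ, hC.dualLabel_apply_aut ha hv hτ]

end InvariantForm

/-! ### Products of simple reflections -/

section ReflectionProducts

variable {I : Type*} [Fintype I] [DecidableEq I] {C : Matrix I I ℤ} {a : I → ℕ} {v : I → ℤ}

theorem derivedReflection_apply_of_ne {i j : I} (h : j ≠ i) (x : DerivedCartan I) :
    derivedReflection C i x j = x j := by
  simp [derivedReflection_apply, derivedCoroot, h]

theorem star_derivedReflection (i : I) (x : DerivedCartan I) :
    derivedReflection C i (star x) = star (derivedReflection C i x) := by
  funext j
  rcases eq_or_ne j i with rfl | hj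
  · simp [derivedReflection_apply, derivedRoot_apply, derivedCoroot]
  · rw [Pi.star_apply, derivedReflection_apply_of_ne hj, derivedReflection_apply_of_ne hj,
      Pi.star_apply]

theorem star_prod_derivedReflection (L : List I) (x : DerivedCartan I) :
    (L.map (derivedReflection C)).prod (star x)
      = star ((L.map (derivedReflection C)).prod x) := by
  induction L with
  | nil => rfl
  | cons i L ih =>
    rw [List.map_cons, List.prod_cons, Module.End.mul_apply, Module.End.mul_apply, ih,
      star_derivedReflection]

theorem IsDualLabels.prod_derivedReflection_central (hv : IsDualLabels C v) (L : List I) :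
    (L.map (derivedReflection C)).prod (central v) = central v := by
  induction L with
  | nil => rfl
  | cons i L ih =>
    rw [List.map_cons, List.prod_cons, Module.End.mul_apply, ih, derivedReflection_apply,
      hv.derivedRoot_central, zero_smul, sub_zero]

theorem IsAffineCartanMatrix.invariantForm_prod_derivedReflection (hC : IsAffineCartanMatrix C)
    (ha : IsKacLabels C a) (hv : IsDualLabels C v) (L : List I) (x y : DerivedCartan I) :
    invariantForm C a v ((L.map (derivedReflection C)).prod x)
      ((L.map (derivedReflection C)).prod y) = invariantForm C a v x y := by
  induction L with
  | nil => rfl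
  | cons i L ih =>
    rw [List.map_cons, List.prod_cons, Module.End.mul_apply, Module.End.mul_apply,
      hC.invariantForm_derivedReflection ha hv, ih]

theorem prod_derivedReflection_apply_of_notMem {L : List I} {i : I} (hi : i ∉ L)
    (x : DerivedCartan I) : (L.map (derivedReflection C)).prod x i = x i := by
  induction L with
  | nil => rfl
  | cons j L ih =>
    rw [List.mem_cons, not_or] at hi
    rw [List.map_cons, List.prod_cons, Module.End.mul_apply, derivedReflection_apply_of_ne hi.1,
      ih hi.2]

/-- A vector fixed by a product of distinct simple reflections is fixed by each of them. -/
theorem derivedRoot_eq_zero_of_prod_eq {L : List I} (hL : L.Nodup) {x : DerivedCartan I}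
    (hx : (L.map (derivedReflection C)).prod x = x) : ∀ i ∈ L, derivedRoot C i x = 0 := by
  induction L with
  | nil => simp
  | cons i L ih =>
    rw [List.nodup_cons] at hL
    rw [List.map_cons, List.prod_cons, Module.End.mul_apply] at hx
    have hx' : (L.map (derivedReflection C)).prod x = x := by
      funext j
      by_cases hj : j = i
      · rw [hj, prod_derivedReflection_apply_of_notMem hL.1]
      · rw [← derivedReflection_apply_of_ne (C := C) hj
          ((L.map (derivedReflection C)).prod x), hx]
    rw [hx', derivedReflection_apply] at hx
    have h := congrFun (sub_eq_self.1 hx) i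
    simp only [derivedCoroot, Pi.smul_apply, Pi.single_eq_same, smul_eq_mul, mul_one,
      Pi.zero_apply] at h
    intro j hj
    rcases List.mem_cons.1 hj with rfl | hj
    · exact h
    · exact ih hL.2 hx' j hj

/-- Prescribing the values of the simple roots on `x` suitably, the inverse of a product of distinct
simple reflections translates `x` by a given combination of the corresponding simple co-roots. The
values depend on the order of the factors, but their pairing with `m` does not. -/
theorem exists_prod_derivedReflection_sub_eq {L : List I} (hL : L.Nodup) (n m : I → ℂ)
    (hC2 : ∀ i, C i i = 2) (hsymm : ∀ i j, n i * C i j * m j = n j * C j i * m i) :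
    ∃ e : I → ℂ,
      (∀ x, (∀ i ∈ L, derivedRoot C i x = e i) →
        (L.map (derivedReflection C)).prod (x - ∑ i ∈ L.toFinset, n i • derivedCoroot i) = x) ∧
      2 * ∑ i ∈ L.toFinset, e i * m i
        = ∑ i ∈ L.toFinset, ∑ j ∈ L.toFinset, n i * C i j * m j := by
  induction L with
  | nil => exact ⟨0, by simp, by simp⟩
  | cons k L ih =>
    rw [List.nodup_cons] at hL
    obtain ⟨e, he, hsum⟩ := ih hL.2
    have hk : k ∉ L.toFinset := by simpa using hL.1
    have hne : ∀ i ∈ L.toFinset, i ≠ k := fun i hi h => hk (h ▸ hi)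
    refine ⟨fun i => if i = k then n k else e i + n k * C k i, fun x hx => ?_, ?_⟩
    · have hxk : derivedRoot C k x = n k := by simpa using hx k (by simp)
      have hL' := he (x - n k • derivedCoroot k) fun i hi => by
        have h := hx i (List.mem_cons_of_mem _ hi)
        simp only [if_neg (hne i (by simpa using hi))] at h
        rw [map_sub, map_smul, derivedRoot_coroot, h, smul_eq_mul]
        ring
      rw [List.toFinset_cons, Finset.sum_insert hk, ← sub_sub, List.map_cons, List.prod_cons,
        Module.End.mul_apply, hL', derivedReflection_apply, map_sub, map_smul, derivedRoot_coroot,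
        hxk, hC2, ← sub_eq_zero]
      push_cast
      rw [smul_eq_mul]
      module
    · have h1 : ∑ i ∈ L.toFinset, (if i = k then n k else e i + n k * C k i) * m i
          = ∑ i ∈ L.toFinset, e i * m i + ∑ i ∈ L.toFinset, n k * C k i * m i := by
        rw [← Finset.sum_add_distrib]
        refine Finset.sum_congr rfl fun i hi => ?_
        rw [if_neg (hne i hi), add_mul]
      have h2 : ∑ i ∈ L.toFinset, n i * C i k * m k = ∑ i ∈ L.toFinset, n k * C k i * m i :=
        Finset.sum_congr rfl fun i _ => hsymm i k
      rw [List.toFinset_cons, Finset.sum_insert hk, Finset.sum_insert hk, Finset.sum_insert hk]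
      simp only [Finset.sum_insert hk, Finset.sum_add_distrib]
      rw [h1, h2, ← hsum, hC2, if_pos trivial]
      push_cast
      ring

end ReflectionProducts

/-! ### Orbits of a diagram automorphism -/

section Orbits

variable {I : Type*} [Fintype I] [DecidableEq I] {τ : Equiv.Perm I} {L : List I}

omit [DecidableEq I] in
theorem apply_eq_of_sameCycle {α : Type*} {p : I → α} (hp : ∀ i, p (τ i) = p i) {i j : I}
    (h : τ.SameCycle i j) : p j = p i := by
  obtain ⟨n, rfl⟩ := h.exists_nat_pow_eq
  induction n with
  | zero => rfl
  | succ n ih => rw [pow_succ', Equiv.Perm.mul_apply, hp, ih ⟨n, by simp⟩]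

omit [Fintype I] [DecidableEq I] in
theorem IsOrbitTransversal.nodup (hL : IsOrbitTransversal τ L) : L.Nodup :=
  hL.1.imp fun h hij => h (by rw [hij])

omit [Fintype I] [DecidableEq I] in
theorem IsOrbitTransversal.eq_of_sameCycle (hL : IsOrbitTransversal τ L) {i j : I} (hi : i ∈ L)
    (hj : j ∈ L) (h : τ.SameCycle i j) : i = j := by
  by_contra hne
  have : Std.Symm fun i j => ¬τ.SameCycle i j := ⟨fun _ _ h h' => h h'.symm⟩
  exact hL.1.forall hi hj hne h

/-- The sum of `f` over the `τ`-orbit of `i`. -/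
def orbitSum {α : Type*} [AddCommMonoid α] (τ : Equiv.Perm I) (f : I → α) (i : I) : α :=
  ∑ j with τ.SameCycle i j, f j

theorem orbitSum_comp_symm {α : Type*} [AddCommMonoid α] (f : I → α) (i : I) :
    orbitSum τ (fun j => f (τ.symm j)) i = orbitSum τ f i :=
  Finset.sum_equiv τ.symm (fun j => by
    simp) (fun _ _ => rfl)

theorem IsOrbitTransversal.sum_orbitSum {α : Type*} [AddCommMonoid α]
    (hL : IsOrbitTransversal τ L) (f : I → α) :
    ∑ i ∈ L.toFinset, orbitSum τ f i = ∑ i, f i := by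
  simp only [orbitSum, Finset.sum_filter]
  rw [Finset.sum_comm]
  refine Finset.sum_congr rfl fun j _ => ?_
  obtain ⟨i, hi, hji⟩ := hL.2 j
  rw [Finset.sum_eq_single_of_mem i (by simpa using hi), if_pos hji.symm]
  intro k hk hki
  exact if_neg fun h => hki (hL.eq_of_sameCycle (by simpa using hk) hi (h.trans hji))

theorem IsOrbitTransversal.orbitSum_eq_of_support {α : Type*} [AddCommMonoid α]
    (hL : IsOrbitTransversal τ L) {f : I → α} (hf : ∀ i ∉ L, f i = 0) {i : I} (hi : i ∈ L) :
    orbitSum τ f i = f i := by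
  refine Finset.sum_eq_single_of_mem i (by simp [Equiv.Perm.SameCycle.refl]) fun j hj hji => ?_
  refine hf j fun hjL => hji (hL.eq_of_sameCycle hjL hi ?_)
  simpa using (Finset.mem_filter.1 hj).2.symm

/-- The image of `τ - 1` consists of the vectors with vanishing orbit sums. -/
theorem IsOrbitTransversal.exists_derivedAut_sub_eq (hL : IsOrbitTransversal τ L)
    {z : DerivedCartan I} (hz : ∀ i ∈ L, orbitSum τ z i = 0) : ∃ x, derivedAut τ x - x = z := by
  by_contra! hcon
  have hmem : z ∉ LinearMap.range ((derivedAut τ).toLinearMap - LinearMap.id) := by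
    rintro ⟨x, hx⟩
    exact hcon x hx
  obtain ⟨φ, hφz, hφ⟩ := Submodule.exists_le_ker_of_notMem hmem
  have hinv : ∀ i, φ (derivedCoroot (τ i)) = φ (derivedCoroot i) := by
    intro i
    have h := hφ (LinearMap.mem_range_self _ (derivedCoroot i))
    rw [LinearMap.mem_ker, LinearMap.sub_apply, map_sub, sub_eq_zero] at h
    rw [← derivedAut_coroot]
    exact h
  apply hφz
  have hφ_sum : φ z = ∑ i, z i * φ (derivedCoroot i) := by
    conv_lhs => rw [pi_eq_sum_univ' z, map_sum]
    refine Finset.sum_congr rfl fun i _ => ?_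
    rw [map_smul, smul_eq_mul]
    congr 2
  rw [hφ_sum, ← hL.sum_orbitSum]
  refine Finset.sum_eq_zero fun i hi => ?_
  rw [← zero_mul (φ (derivedCoroot i)), ← hz i (by simpa using hi), orbitSum, orbitSum,
    Finset.sum_mul]
  refine Finset.sum_congr rfl fun j hj => ?_
  rw [apply_eq_of_sameCycle (p := fun i => φ (derivedCoroot i)) hinv (Finset.mem_filter.1 hj).2]

end Orbits

/-! ### The Jordan block of the twisted Coxeter element -/

section DerivedCoxeter

variable {I : Type*} [Fintype I] [DecidableEq I] {C : Matrix I I ℤ} {a : I → ℕ} {v : I → ℤ}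
  {τ : Equiv.Perm I} {L : List I}

theorem derivedTwistedCoxeter_apply (x : DerivedCartan I) :
    derivedTwistedCoxeter C τ L x = (L.map (derivedReflection C)).prod (derivedAut τ x) := rfl

theorem star_derivedTwistedCoxeter (x : DerivedCartan I) :
    derivedTwistedCoxeter C τ L (star x) = star (derivedTwistedCoxeter C τ L x) := by
  rw [derivedTwistedCoxeter_apply, derivedTwistedCoxeter_apply, ← star_prod_derivedReflection]
  rfl

/-- The fixed vectors of the twisted Coxeter element are the multiples of the central element. -/
theorem IsAffineCartanMatrix.exists_eq_smul_central_of_fixed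
    (hC : IsAffineCartanMatrix C) (ha : IsKacLabels C a) (hv : IsDualLabels C v)
    (hτ : τ ∈ diagramAut C) (hL : IsOrbitTransversal τ L) {x : DerivedCartan I}
    (hx : derivedTwistedCoxeter C τ L x = x) : ∃ t : ℂ, x = t • central v := by
  rw [derivedTwistedCoxeter_apply] at hx
  -- `x - τ x` is supported on `L` and has vanishing orbit sums
  have hsupp : ∀ i ∉ L, (x - derivedAut τ x) i = 0 := by
    intro i hi
    rw [Pi.sub_apply, sub_eq_zero]
    conv_lhs => rw [← hx]
    exact prod_derivedReflection_apply_of_notMem hi _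
  have horb : ∀ i, orbitSum τ (x - derivedAut τ x) i = 0 := by
    intro i
    have h := orbitSum_comp_symm (τ := τ) x i
    simp only [orbitSum, Pi.sub_apply, Finset.sum_sub_distrib] at h ⊢
    rw [sub_eq_zero, ← h]
    rfl
  have hfix : derivedAut τ x = x := by
    rw [eq_comm, ← sub_eq_zero]
    funext i
    by_cases hi : i ∈ L
    · rw [← hL.orbitSum_eq_of_support hsupp hi, horb, Pi.zero_apply]
    · exact hsupp i hi
  rw [hfix] at hx
  have hroot := derivedRoot_eq_zero_of_prod_eq hL.nodup hx
  refine hC.exists_eq_smul_central ha hv fun i => ?_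
  obtain ⟨j, hj, hij⟩ := hL.2 i
  rw [← hroot j hj]
  refine (apply_eq_of_sameCycle (p := fun i => derivedRoot C i x) (fun i => ?_) hij).symm
  conv_lhs => rw [← hfix]
  exact derivedRoot_derivedAut hτ i x

theorem IsAffineCartanMatrix.derivedTwistedCoxeter_central [Nonempty I]
    (hC : IsAffineCartanMatrix C) (ha : IsKacLabels C a) (hv : IsDualLabels C v)
    (hτ : τ ∈ diagramAut C) : derivedTwistedCoxeter C τ L (central v) = central v := by
  rw [derivedTwistedCoxeter_apply, hC.derivedAut_central ha hv hτ,
    hv.prod_derivedReflection_central]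

theorem IsAffineCartanMatrix.invariantForm_derivedTwistedCoxeter [Nonempty I]
    (hC : IsAffineCartanMatrix C) (ha : IsKacLabels C a) (hv : IsDualLabels C v)
    (hτ : τ ∈ diagramAut C) (x y : DerivedCartan I) :
    invariantForm C a v (derivedTwistedCoxeter C τ L x) (derivedTwistedCoxeter C τ L y)
      = invariantForm C a v x y := by
  rw [derivedTwistedCoxeter_apply, derivedTwistedCoxeter_apply,
    hC.invariantForm_prod_derivedReflection ha hv, hC.invariantForm_derivedAut ha hv hτ]

/-- The twisted Coxeter element has no Jordan block of size three for the eigenvalue `1`, because it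
is unitary modulo the central element. -/
theorem IsAffineCartanMatrix.exists_eq_smul_central_of_mem_range [Nonempty I]
    (hC : IsAffineCartanMatrix C) (ha : IsKacLabels C a) (hv : IsDualLabels C v)
    (hτ : τ ∈ diagramAut C) {y z : DerivedCartan I} {k : ℂ}
    (hyz : derivedTwistedCoxeter C τ L z - z = y)
    (hy : derivedTwistedCoxeter C τ L y = y + k • central v) : ∃ t : ℂ, y = t • central v := by
  apply hC.exists_eq_smul_central_of_isotropic ha hv
  set w := derivedTwistedCoxeter C τ L with hw
  have hstar : star y = w (star y) - star k • central v := by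
    rw [hw, star_derivedTwistedCoxeter, ← hw, hy, star_add, star_smul]
    have : star (central v) = central v := by
      funext i
      simp [central]
    rw [this, add_sub_cancel_right]
  have h1 : invariantForm C a v (star y) (w z) = invariantForm C a v (star y) z := by
    conv_lhs => rw [hstar]
    rw [map_sub, map_smul, LinearMap.sub_apply, LinearMap.smul_apply,
      hv.invariantForm_central_left, smul_zero, sub_zero,
      hC.invariantForm_derivedTwistedCoxeter ha hv hτ]
  rw [show invariantForm C a v (star y) y = invariantForm C a v (star y) (w z - z) by rw [hyz],
    map_sub, h1, sub_self]

/-- The Jordan block of the central element has size at least two. Writing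
`τ x = x + central v - ρ` with `ρ` in the span of the simple co-roots indexed by `L`, the vector `x`
has to satisfy one linear condition for each element of `L`, and the only relation between these is
fulfilled because `x` and `τ x` have the same norm. -/
theorem IsAffineCartanMatrix.exists_derivedTwistedCoxeter_eq_add_central [Nonempty I]
    (hC : IsAffineCartanMatrix C) (ha : IsKacLabels C a) (hv : IsDualLabels C v)
    (hτ : τ ∈ diagramAut C) (hL : IsOrbitTransversal τ L) :
    ∃ x, derivedTwistedCoxeter C τ L x = x + central v := by
  set n : I → ℂ := orbitSum τ (central v) with hn
  set m : I → ℂ := fun i => n i * (a i / v i) with hm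
  set ρ : DerivedCartan I := ∑ i ∈ L.toFinset, n i • derivedCoroot i with hρ
  have hρ_apply : ∀ i, ρ i = if i ∈ L then n i else 0 := by
    intro i
    simp [hρ, derivedCoroot, Pi.single_apply, Finset.sum_apply]
  obtain ⟨x₀, hx₀⟩ := hL.exists_derivedAut_sub_eq (z := central v - ρ) (fun i hi => by
    have h := hL.orbitSum_eq_of_support (f := ρ) (fun j hj => by rw [hρ_apply, if_neg hj]) hi
    rw [hρ_apply, if_pos hi, hn] at h
    simp only [orbitSum, Pi.sub_apply, Finset.sum_sub_distrib] at h ⊢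
    rw [h, sub_self])
  have hform : ∀ i j, invariantForm C a v (derivedCoroot i) (derivedCoroot j)
      = C i j * (a j / v j) := fun i j => by
    rw [invariantForm_coroot_right, derivedRoot_coroot, mul_comm]
  obtain ⟨e, he, hsum⟩ := exists_prod_derivedReflection_sub_eq (C := C) hL.nodup n m hC.diag
    (fun i j => by
      have h := hC.invariantForm_comm ha hv (derivedCoroot i) (derivedCoroot j)
      rw [hform, hform] at h
      simp only [hm]
      linear_combination n i * n j * h)
  have hρρ : invariantForm C a v ρ ρ
      = ∑ i ∈ L.toFinset, ∑ j ∈ L.toFinset, n i * C i j * m j := by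
    simp only [hρ, map_sum, LinearMap.sum_apply, map_smul, LinearMap.smul_apply, hform, smul_eq_mul]
    simp only [Finset.mul_sum]
    rw [Finset.sum_comm]
    refine Finset.sum_congr rfl fun i _ => Finset.sum_congr rfl fun j _ => ?_
    simp only [hm]
    ring
  have hρx : invariantForm C a v ρ x₀ = ∑ i ∈ L.toFinset, derivedRoot C i x₀ * m i := by
    simp only [hρ, map_sum, LinearMap.sum_apply, map_smul, LinearMap.smul_apply, smul_eq_mul,
      hC.invariantForm_coroot_left ha hv]
    exact Finset.sum_congr rfl fun i _ => by simp only [hm]; ring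
  have hnorm : invariantForm C a v ρ ρ = 2 * invariantForm C a v ρ x₀ := by
    have h1 := hC.invariantForm_derivedAut ha hv hτ x₀ x₀
    have h2 : derivedAut τ x₀ = x₀ + central v - ρ := by
      rw [add_sub_assoc, ← hx₀, add_sub_cancel]
    rw [h2] at h1
    simp only [map_sub, map_add, LinearMap.sub_apply, LinearMap.add_apply,
      hv.invariantForm_central_left, hC.invariantForm_central_right ha hv,
      hC.invariantForm_comm ha hv x₀ ρ] at h1
    linear_combination h1
  choose r hrL hr using hL.2
  set E : I → ℂ := fun j => e (r j) - derivedRoot C (r j) x₀ with hE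
  have hr_eq : ∀ i j, τ.SameCycle i j → r i = r j := fun i j h =>
    hL.eq_of_sameCycle (hrL i) (hrL j) ((hr i).symm.trans (h.trans (hr j)))
  have hr_self : ∀ i ∈ L, r i = i := fun i hi => (hL.eq_of_sameCycle hi (hrL i) (hr i)).symm
  have horb : ∀ i ∈ L.toFinset,
      orbitSum τ (fun j => (a j : ℂ) * E j) i = e i * m i - derivedRoot C i x₀ * m i := by
    intro i hi
    rw [← sub_mul]
    simp only [hm, hn, orbitSum]
    rw [Finset.sum_mul, Finset.mul_sum]
    refine Finset.sum_congr rfl fun j hj => ?_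
    have hij : τ.SameCycle i j := (Finset.mem_filter.1 hj).2
    have hv0 := hv.cast_ne_zero i
    simp only [hE, central]
    rw [← hr_eq i j hij, hr_self i (by simpa using hi),
      apply_eq_of_sameCycle (hC.label_apply_aut ha hv hτ) hij,
      apply_eq_of_sameCycle (hC.dualLabel_apply_aut ha hv hτ) hij]
    field_simp
  obtain ⟨y, hy⟩ := hC.exists_derivedRoot_eq ha hv (e := E) (by
    rw [← hL.sum_orbitSum, Finset.sum_congr rfl horb, Finset.sum_sub_distrib, ← hρx]
    linear_combination (hsum - hρρ + hnorm) / 2)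
  have hyτ : derivedAut τ y = y := by
    obtain ⟨t, ht⟩ := hC.exists_eq_smul_central ha hv (x := derivedAut τ y - y) (fun j => by
      have h := derivedRoot_derivedAut hτ (τ.symm j) y
      have hcyc : τ.SameCycle (τ.symm j) j := by
        simpa using (Equiv.Perm.sameCycle_apply_right (f := τ)).2
          (Equiv.Perm.SameCycle.refl τ (τ.symm j))
      rw [Equiv.apply_symm_apply] at h
      rw [map_sub, h, hy, hy]
      simp only [hE]
      rw [hr_eq _ _ hcyc, sub_self])
    have hsum_v : (∑ i, v i : ℂ) ≠ 0 := by
      have := Finset.sum_pos (fun i _ => hv.pos i) Finset.univ_nonempty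
      exact_mod_cast this.ne'
    have h1 : t * ∑ i, (v i : ℂ) = 0 := by
      have h2 : ∑ i, (derivedAut τ y - y) i = 0 := by
        simp only [Pi.sub_apply, derivedAut_apply, Finset.sum_sub_distrib]
        rw [Equiv.sum_comp τ.symm y, sub_self]
      rw [← h2, ht, Finset.mul_sum]
      rfl
    rw [← sub_eq_zero, ht, (mul_eq_zero.1 h1).resolve_right hsum_v, zero_smul]
  refine ⟨x₀ + y, ?_⟩
  have hτx : derivedAut τ (x₀ + y) = (x₀ + y - ρ) + central v := by
    rw [map_add, hyτ, ← sub_add_cancel (derivedAut τ x₀) x₀, hx₀]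
    abel
  rw [derivedTwistedCoxeter_apply, hτx, map_add, hv.prod_derivedReflection_central,
    he (x₀ + y) fun i hi => ?_]
  rw [map_add, hy]
  simp only [hE]
  rw [hr_self i hi]
  ring

end DerivedCoxeter

/-! ### The multiplicity on `𝔥'` -/

section Multiplicity

/-- If `c` spans the fixed vectors of `f` and the only Jordan block for the eigenvalue `1` has size
exactly two, then `1` is a double zero of the characteristic polynomial. -/
theorem rootMultiplicity_charpoly_one_eq_two {K V : Type*} [Field K] [AddCommGroup V] [Module K V]
    [FiniteDimensional K V] (f : Module.End K V) {c x₀ : V} (hc0 : c ≠ 0) (hc : f c = c)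
    (hfix : ∀ x, f x = x → ∃ t : K, x = t • c) (hx₀ : f x₀ = x₀ + c)
    (hblock : ∀ y z, f z - z = y → (∃ k : K, f y = y + k • c) → ∃ t : K, y = t • c) :
    f.charpoly.rootMultiplicity 1 = 2 := by
  rw [← LinearMap.finrank_maxGenEigenspace_eq]
  have hN : ∀ x, (f - (1 : K) • (1 : Module.End K V)) x = f x - x := fun x => by simp
  have hsq : ∀ x, (∃ k : K, f x - x = k • c) → x ∈ Submodule.span K {c, x₀} := by
    rintro x ⟨k, hk⟩
    obtain ⟨t, ht⟩ := hfix (x - k • x₀) (by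
      rw [map_sub, map_smul, hx₀, eq_add_of_sub_eq hk]
      module)
    rw [Submodule.mem_span_pair]
    exact ⟨t, k, by rw [← ht]; abel⟩
  have hpow : ∀ (n : ℕ) x, ((f - (1 : K) • (1 : Module.End K V)) ^ n) x = 0 →
      ∃ k : K, f x - x = k • c := by
    intro n
    induction n with
    | zero =>
      intro x hx
      have hx : x = 0 := by simpa using hx
      exact ⟨0, by simp [hx]⟩
    | succ n ih =>
      intro x hx
      rw [pow_succ, Module.End.mul_apply, hN] at hx
      obtain ⟨k, hk⟩ := ih _ hx
      exact hblock _ x rfl ⟨k, eq_add_of_sub_eq' hk⟩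
  have hspan : f.maxGenEigenspace 1 = Submodule.span K {c, x₀} := by
    apply le_antisymm
    · intro x hx
      obtain ⟨n, hn⟩ := (Module.End.mem_maxGenEigenspace _ _ _).1 hx
      exact hsq x (hpow n x hn)
    · rw [Submodule.span_le]
      rintro x (rfl | rfl)
      · exact (Module.End.mem_maxGenEigenspace _ _ _).2 ⟨1, by rw [pow_one, hN, hc, sub_self]⟩
      · refine (Module.End.mem_maxGenEigenspace _ _ _).2 ⟨2, ?_⟩
        rw [pow_two, Module.End.mul_apply, hN x, hx₀, add_sub_cancel_left, hN, hc, sub_self]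
  have hli : LinearIndependent K ![c, x₀] := by
    rw [LinearIndependent.pair_iff]
    intro s t hst
    have h := congrArg f hst
    rw [map_add, map_smul, map_smul, hc, hx₀, smul_add, ← add_assoc, hst, zero_add, map_zero] at h
    have ht := (smul_eq_zero.1 h).resolve_right hc0
    rw [ht, zero_smul, add_zero] at hst
    exact ⟨(smul_eq_zero.1 hst).resolve_right hc0, ht⟩
  have h := finrank_span_eq_card hli
  rw [hspan, ← Matrix.range_cons_cons_empty, h, Fintype.card_fin]

/-- The characteristic polynomial of a block triangular endomorphism of a product. -/
theorem charpoly_eq_mul_of_comp_inl {R M₁ M₂ : Type*} [CommRing R] [Nontrivial R]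
    [AddCommGroup M₁] [AddCommGroup M₂] [Module R M₁] [Module R M₂] [Module.Free R M₁]
    [Module.Free R M₂] [Module.Finite R M₁] [Module.Finite R M₂] (F : Module.End R (M₁ × M₂))
    (f : Module.End R M₁) (g : Module.End R M₂)
    (hf : ∀ x, F (x, 0) = (f x, 0)) (hg : ∀ y, (F (0, y)).2 = g y) :
    F.charpoly = f.charpoly * g.charpoly := by
  let b₁ := Module.Free.chooseBasis R M₁
  let b₂ := Module.Free.chooseBasis R M₂
  have hblocks : LinearMap.toMatrix (b₁.prod b₂) (b₁.prod b₂) F = Matrix.fromBlocks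
      (LinearMap.toMatrix b₁ b₁ f)
      (Matrix.of fun i j => b₁.repr (F (0, b₂ j)).1 i) 0 (LinearMap.toMatrix b₂ b₂ g) := by
    ext (i | i) (j | j) <;> simp [LinearMap.toMatrix_apply, hf, hg]
  rw [← LinearMap.charpoly_toMatrix f b₁, ← LinearMap.charpoly_toMatrix g b₂,
    ← LinearMap.charpoly_toMatrix F (b₁.prod b₂), hblocks, Matrix.charpoly_fromBlocks_zero₂₁]

variable {I : Type*} [Fintype I] [DecidableEq I] {C : Matrix I I ℤ} {a : I → ℕ} {v : I → ℤ}
  {τ : Equiv.Perm I} {L : List I}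

theorem IsAffineCartanMatrix.rootMultiplicity_charpoly_derivedTwistedCoxeter [Nonempty I]
    (hC : IsAffineCartanMatrix C) (ha : IsKacLabels C a) (hv : IsDualLabels C v)
    (hτ : τ ∈ diagramAut C) (hL : IsOrbitTransversal τ L) :
    (derivedTwistedCoxeter C τ L).charpoly.rootMultiplicity 1 = 2 := by
  obtain ⟨x₀, hx₀⟩ := hC.exists_derivedTwistedCoxeter_eq_add_central ha hv hτ hL
  refine rootMultiplicity_charpoly_one_eq_two _ (c := central v) (fun h => ?_)
    (hC.derivedTwistedCoxeter_central ha hv hτ)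
    (fun x hx => hC.exists_eq_smul_central_of_fixed ha hv hτ hL hx) hx₀
    (fun y z hyz ⟨k, hk⟩ => hC.exists_eq_smul_central_of_mem_range ha hv hτ hyz hk)
  exact hv.cast_ne_zero (Classical.arbitrary I) (congrFun h _)

end Multiplicity

/-! ### Lifts and the multiplicity on `𝔥` -/

section FullCartan

variable {I : Type*} [Fintype I] [DecidableEq I] {C : Matrix I I ℤ} {a : I → ℕ} {v : I → ℤ} {o : I}
  {τ : Equiv.Perm I} {L : List I}

theorem root_apply (i : I) (x : FullCartan I) :
    root C a o i x = derivedRoot C i x.1 + (if i = o then (a o : ℂ)⁻¹ else 0) * x.2 := by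
  rw [root, LinearMap.coprod_apply, LinearMap.smul_apply, LinearMap.id_apply, smul_eq_mul]

theorem IsKacLabels.sum_mul_root (ha : IsKacLabels C a) (x : FullCartan I) :
    ∑ i, (a i : ℂ) * root C a o i x = x.2 := by
  simp only [root_apply, mul_add, Finset.sum_add_distrib, ha.sum_mul_derivedRoot]
  simp [ha.cast_ne_zero o]

theorem prod_reflection_inl (x : DerivedCartan I) :
    (L.map (reflection C a o)).prod (x, 0) = ((L.map (derivedReflection C)).prod x, 0) := by
  induction L with
  | nil => rfl
  | cons i L ih =>
    rw [List.map_cons, List.prod_cons, List.map_cons, List.prod_cons, Module.End.mul_apply,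
      Module.End.mul_apply, ih]
    simp [reflection, Module.preReflection_apply, coroot, root_apply, derivedReflection_apply]

theorem prod_reflection_snd (x : FullCartan I) :
    ((L.map (reflection C a o)).prod x).2 = x.2 := by
  induction L with
  | nil => rfl
  | cons i L ih =>
    rw [List.map_cons, List.prod_cons, Module.End.mul_apply]
    simp [reflection, Module.preReflection_apply, coroot, ih]

theorem IsLift.apply_inl {T : FullCartan I ≃ₗ[ℂ] FullCartan I} (hT : IsLift C a o τ T)
    (x : DerivedCartan I) : T (x, 0) = (derivedAut τ x, 0) := by
  have h : T.toLinearMap ∘ₗ LinearMap.inl ℂ (DerivedCartan I) ℂ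
      = LinearMap.inl ℂ (DerivedCartan I) ℂ ∘ₗ (derivedAut τ).toLinearMap := by
    refine LinearMap.pi_ext' fun i => LinearMap.ext_ring ?_
    change T (coroot i) = (derivedAut τ (derivedCoroot i), 0)
    rw [hT.map_coroot, derivedAut_coroot]
    rfl
  exact LinearMap.congr_fun h x

theorem IsAffineCartanMatrix.isLift_apply_d_snd [Nonempty I] (hC : IsAffineCartanMatrix C)
    (ha : IsKacLabels C a) (hv : IsDualLabels C v) (hτ : τ ∈ diagramAut C)
    {T : FullCartan I ≃ₗ[ℂ] FullCartan I} (hT : IsLift C a o τ T) : (T (d I)).2 = 1 := by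
  rw [← ha.sum_mul_root (o := o), ← Equiv.sum_comp τ]
  simp only [hC.label_apply_aut ha hv hτ, hT.root_map_d]
  rw [ha.sum_mul_root]
  rfl

theorem IsAffineCartanMatrix.exists_isLift [Nonempty I] (hC : IsAffineCartanMatrix C)
    (ha : IsKacLabels C a) (hv : IsDualLabels C v) (hτ : τ ∈ diagramAut C) (o : I) :
    ∃ T, IsLift C a o τ T := by
  have ho := ha.cast_ne_zero o
  have hsymm : a (τ.symm o) = a o := by
    rw [← hC.label_apply_aut ha hv hτ, Equiv.apply_symm_apply]
  -- the part `y` of the image of `d` in `𝔥'` has to satisfy these linear equations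
  obtain ⟨y, hy⟩ := hC.exists_derivedRoot_eq ha hv (e := fun j =>
    (if τ.symm j = o then (a o : ℂ)⁻¹ else 0) - if j = o then (a o : ℂ)⁻¹ else 0) (by
      simp only [mul_sub, Finset.sum_sub_distrib, Equiv.symm_apply_eq]
      simp [hC.label_apply_aut ha hv hτ])
  refine ⟨LinearEquiv.ofLinearMap
    (((derivedAut τ).toLinearMap.coprod (LinearMap.toSpanSingleton ℂ _ y)).prod
      (LinearMap.snd ℂ _ _))
    (((derivedAut τ).symm.toLinearMap.coprod
      (LinearMap.toSpanSingleton ℂ _ (-(derivedAut τ).symm y))).prod (LinearMap.snd ℂ _ _))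
    ?_ ?_, ?_, ?_⟩
  · refine LinearMap.ext fun x => Prod.ext ?_ ?_ <;> simp
  · refine LinearMap.ext fun x => Prod.ext ?_ ?_ <;> simp
  · intro i
    simp [coroot, derivedAut_coroot]
  · intro i
    simp [root_apply, d, hy]

theorem IsAffineCartanMatrix.rootMultiplicity_charpoly_twistedCoxeter [Nonempty I]
    (hC : IsAffineCartanMatrix C) (ha : IsKacLabels C a) (hv : IsDualLabels C v)
    (hτ : τ ∈ diagramAut C) (hL : IsOrbitTransversal τ L)
    {T : FullCartan I ≃ₗ[ℂ] FullCartan I} (hT : IsLift C a o τ T) :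
    (twistedCoxeter C a o L T).charpoly.rootMultiplicity 1 = 3 := by
  have h := charpoly_eq_mul_of_comp_inl (twistedCoxeter C a o L T) (derivedTwistedCoxeter C τ L)
    (1 : Module.End ℂ ℂ) (fun x => by
      rw [twistedCoxeter, Module.End.mul_apply, LinearEquiv.coe_coe, hT.apply_inl,
        prod_reflection_inl]
      rfl) (fun t => by
      have ht : ((0, t) : FullCartan I) = t • d I := by simp [d]
      rw [twistedCoxeter, Module.End.mul_apply, LinearEquiv.coe_coe, prod_reflection_snd, ht,
        map_smul, Prod.smul_snd, hC.isLift_apply_d_snd ha hv hτ hT]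
      simp)
  have hone : (1 : Module.End ℂ ℂ).charpoly = Polynomial.X - Polynomial.C 1 := by
    simp [LinearMap.charpoly_one]
  rw [h, Polynomial.rootMultiplicity_mul
    (mul_ne_zero (LinearMap.charpoly_monic _).ne_zero (LinearMap.charpoly_monic _).ne_zero),
    hC.rootMultiplicity_charpoly_derivedTwistedCoxeter ha hv hτ hL, hone,
    Polynomial.rootMultiplicity_X_sub_C_self]

end FullCartan

end AffineCoxeter

theorem mainTheorem6 {I : Type*} [Fintype I] [DecidableEq I] (C : Matrix I I ℤ)
    (hC : AffineCoxeter.IsAffineCartanMatrix C) (a : I → ℕ) (ha : AffineCoxeter.IsKacLabels C a)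
    (o : I) (τ : Equiv.Perm I) (hτ : τ ∈ AffineCoxeter.diagramAut C)
    (L : List I) (hL : AffineCoxeter.IsOrbitTransversal τ L) :
    (AffineCoxeter.derivedTwistedCoxeter C τ L).charpoly.rootMultiplicity 1 = 2 ∧
    (∃ T, AffineCoxeter.IsLift C a o τ T) ∧
    ∀ T, AffineCoxeter.IsLift C a o τ T →
      (AffineCoxeter.twistedCoxeter C a o L T).charpoly.rootMultiplicity 1 = 3 := by
  have : Nonempty I := ⟨o⟩
  obtain ⟨v, hpos, hker⟩ := hC.exists_pos_vecMul_eq_zero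
  have hv : AffineCoxeter.IsDualLabels C v := ⟨hpos, hker⟩
  exact ⟨hC.rootMultiplicity_charpoly_derivedTwistedCoxeter ha hv hτ hL,
    hC.exists_isLift ha hv hτ o,
    fun T hT => hC.rootMultiplicity_charpoly_twistedCoxeter ha hv hτ hL hT⟩
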